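/- Theorem 4.5. Let $\Gamma=(V,E,s,r)$ be a row-finite directed graph with $V\neq\varnothing$ (each $v\in V$ is the source of only finitely many edges) and let $S$ be a commutative semiring (with zero and identity) in which $0\ne 1$. Let $L_S(\Gamma)$ be the Leavitt path algebra, i.e. the associative, not necessarily unital, $S$-algebra presented by the generators $V\cup E\cup\{e^*: e\in E\}$ and the relations (i) $vv'=\delta_{v,v'}v$ for $v,v'\in V$; (ii) $s(e)e=e=e\,r(e)$ and $r(e)e^*=e^*=e^*s(e)$ for $e\in E$; (iii) $e^*f=\delta_{e,f}\,r(e)$ for $e,f\in E$; (iv) $v=\sum_{e\in s^{-1}(v)}ee^*$ for every regular vertex $v$, i.e. every $v$ with $0<|s^{-1}(v)|<\infty$. Then $L_S(\Gamma)$ is congruence-simple (the diagonal and the universal relation are the only equivalence relations on it that are compatible with its addition and multiplication) if and only if the following three conditions hold: (1) $S$ is either a field or (isomorphic to) the Boolean semifield $\mathbf B=\{0,1\}$ with $1+1=1$; (2) the only hereditary and saturated subsets of $V$ are $\varnothing$ and $V$, where $H\subseteq V$ is hereditary if $s(e)\in H$ implies $r(e)\in H$ for all $e\in E$, and saturated if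 every regular vertex $v$ with $r(s^{-1}(v))\subseteq H$ lies in $H$; (3) every cycle of $\Gamma$ has an exit, where a cycle is a closed path $e_1\cdots e_n$ ($n\ge 1$, $r(e_i)=s(e_{i+1})$ for $i<n$, $r(e_n)=s(e_1)$) whose sources $s(e_1),\dots,s(e_n)$ are distinct, and an exit is an edge $f$ such that $s(f)=s(e_i)$ and $f\neq e_i$ for some $i$. -/

import Mathlib

namespace LeavittPath

universe u v w

/-- A directed graph with vertex set `V` and edge set `E`, given by the source map `s` and the
range map `r`. Loops and parallel edges are allowed. -/
structure DirectedGraph (V : Type u) (E : Type v) where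
  s : E → V
  r : E → V

namespace DirectedGraph

variable {V : Type u} {E : Type v} (Γ : DirectedGraph V E)

/-- Every vertex emits only finitely many edges. -/
def RowFinite : Prop := ∀ x : V, {e : E | Γ.s e = x}.Finite

/-- A vertex is regular if it emits at least one and only finitely many edges. -/
def IsRegular (x : V) : Prop := {e : E | Γ.s e = x}.Nonempty ∧ {e : E | Γ.s e = x}.Finite

/-- A set of vertices is hereditary if it contains the range of every edge whose source it
contains. -/
def Hereditary (H : Set V) : Prop := ∀ e : E, Γ.s e ∈ H → Γ.r e ∈ H

/-- A set of vertices is saturated if it contains every regular vertex all of whose emitted edges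
end in it. -/
def Saturated (H : Set V) : Prop :=
  ∀ x : V, Γ.IsRegular x → (∀ e : E, Γ.s e = x → Γ.r e ∈ H) → x ∈ H

/-- The list `p = [e₁, …, eₙ]` of edges, `n ≥ 1`, is a closed path whose sources
`s(e₁), …, s(eₙ)` are pairwise distinct. -/
structure IsCycle (p : List E) : Prop where
  ne_nil : p ≠ []
  chain : p.IsChain (fun e f => Γ.r e = Γ.s f)
  closed : Γ.r (p.getLast ne_nil) = Γ.s (p.head ne_nil)
  nodup : (p.map Γ.s).Nodup

/-- The edge `f` is an exit for the path `p`. -/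
def IsExit (f : E) (p : List E) : Prop := ∃ e ∈ p, Γ.s f = Γ.s e ∧ f ≠ e

end DirectedGraph

/-- The generators of the Leavitt path algebra: vertices, edges and ghost edges `e*`. -/
inductive Gen (V : Type u) (E : Type v) : Type (max u v)
  | vertex (x : V) : Gen V E
  | edge (e : E) : Gen V E
  | ghost (e : E) : Gen V E

/-- The free (associative, not necessarily unital) `S`-algebra on the generators: polynomials
without constant term in noncommuting indeterminates, i.e. the semigroup algebra of the free
semigroup. -/
abbrev FreeAlg (S : Type w) [CommSemiring S] (V : Type u) (E : Type v) : Type (max u v w) :=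
  MonoidAlgebra S (FreeSemigroup (Gen V E))

section

variable (S : Type w) [CommSemiring S] {V : Type u} {E : Type v}

/-- The generator `g` as an element of the free algebra. -/
noncomputable def gen (g : Gen V E) : FreeAlg S V E :=
  MonoidAlgebra.single (FreeSemigroup.of g) 1

/-- The vertex `x` in the free algebra. -/
noncomputable abbrev vtx (x : V) : FreeAlg S V E := gen S (Gen.vertex x)

/-- The edge `e` in the free algebra. -/
noncomputable abbrev edg (e : E) : FreeAlg S V E := gen S (Gen.edge e)

/-- The ghost edge `e*` in the free algebra. -/
noncomputable abbrev gst (e : E) : FreeAlg S V E := gen S (Gen.ghost e)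

/-- The defining relations of the Leavitt path algebra. -/
inductive Rel (Γ : DirectedGraph V E) : FreeAlg S V E → FreeAlg S V E → Prop
  | vertex_self (x : V) : Rel Γ (vtx S x * vtx S x) (vtx S x)
  | vertex_ne (x y : V) : x ≠ y → Rel Γ (vtx S x * vtx S y) 0
  | source_edge (e : E) : Rel Γ (vtx S (Γ.s e) * edg S e) (edg S e)
  | edge_range (e : E) : Rel Γ (edg S e * vtx S (Γ.r e)) (edg S e)
  | range_ghost (e : E) : Rel Γ (vtx S (Γ.r e) * gst S e) (gst S e)
  | ghost_source (e : E) : Rel Γ (gst S e * vtx S (Γ.s e)) (gst S e)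
  | ghost_edge_self (e : E) : Rel Γ (gst S e * edg S e) (vtx S (Γ.r e))
  | ghost_edge_ne (e f : E) : e ≠ f → Rel Γ (gst S e * edg S f) 0
  | regular (x : V) (h : Γ.IsRegular x) :
      Rel Γ (vtx S x) (∑ e ∈ h.2.toFinset, edg S e * gst S e)

/-- The `S`-algebra congruence generated by the defining relations. As the free algebra has no
unit, scalar multiples of the relations are added explicitly; `con_smul` below shows that the
result is stable under scalars. -/
noncomputable def con (Γ : DirectedGraph V E) : RingCon (FreeAlg S V E) :=
  ringConGen fun x y => ∃ (c : S) (a b : FreeAlg S V E), Rel S Γ a b ∧ x = c • a ∧ y = c • b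

theorem con_smul (Γ : DirectedGraph V E) (c : S) {x y : FreeAlg S V E} (h : con S Γ x y) :
    con S Γ (c • x) (c • y) := by
  change RingConGen.Rel _ x y at h
  change RingConGen.Rel _ (c • x) (c • y)
  induction h with
  | of x y h =>
    obtain ⟨d, a, b, hab, rfl, rfl⟩ := h
    exact RingConGen.Rel.of _ _ ⟨c * d, a, b, hab, smul_smul _ _ _, smul_smul _ _ _⟩
  | refl x => exact RingConGen.Rel.refl _
  | symm _ ih => exact ih.symm
  | trans _ _ ih₁ ih₂ => exact ih₁.trans ih₂
  | add _ _ ih₁ ih₂ =>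
    rw [smul_add, smul_add]
    exact ih₁.add ih₂
  | mul _ h₂ ih₁ _ =>
    rw [← smul_mul_assoc, ← smul_mul_assoc]
    exact ih₁.mul h₂

end

/-- The Leavitt path algebra `L_S(Γ)`: the `S`-algebra presented by the generators `V ∪ E ∪ E*`
and the defining relations. It need not have a unit. -/
abbrev LeavittPathAlgebra (S : Type w) [CommSemiring S] {V : Type u} {E : Type v}
    (Γ : DirectedGraph V E) : Type (max u v w) :=
  (con S Γ).Quotient

section

variable (S : Type w) [CommSemiring S] {V : Type u} {E : Type v} (Γ : DirectedGraph V E)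

noncomputable instance : SMul S (LeavittPathAlgebra S Γ) where
  smul c := Quotient.map' (fun x => c • x) fun _ _ h => con_smul S Γ c h

noncomputable instance : Module S (LeavittPathAlgebra S Γ) where
  one_smul := by
    rintro ⟨x⟩
    exact congrArg (Quot.mk _) (one_smul S x)
  mul_smul := by
    rintro c d ⟨x⟩
    exact congrArg (Quot.mk _) (mul_smul c d x)
  smul_zero c := congrArg (Quot.mk _) (smul_zero c)
  smul_add := by
    rintro c ⟨x⟩ ⟨y⟩
    exact congrArg (Quot.mk _) (smul_add c x y)
  add_smul := by
    rintro c d ⟨x⟩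
    exact congrArg (Quot.mk _) (add_smul c d x)
  zero_smul := by
    rintro ⟨x⟩
    exact congrArg (Quot.mk _) (zero_smul S x)

instance : IsScalarTower S (LeavittPathAlgebra S Γ) (LeavittPathAlgebra S Γ) where
  smul_assoc := by
    rintro c ⟨x⟩ ⟨y⟩
    exact congrArg (Quot.mk _) (smul_mul_assoc c x y)

instance : SMulCommClass S (LeavittPathAlgebra S Γ) (LeavittPathAlgebra S Γ) where
  smul_comm := by
    rintro c ⟨x⟩ ⟨y⟩
    exact congrArg (Quot.mk _) (mul_smul_comm c x y).symm

end

/-- A hemiring is congruence-simple if the diagonal and the universal congruence are its only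
congruences. -/
def CongruenceSimple (A : Type u) [NonUnitalSemiring A] : Prop :=
  ∀ c : RingCon A, c = ⊥ ∨ c = ⊤

/-- The Boolean semifield `{0, 1}` with `1 + 1 = 1`. -/
inductive BooleanSemifield : Type
  | zero
  | one

namespace BooleanSemifield

/-- Addition is the maximum. -/
def add : BooleanSemifield → BooleanSemifield → BooleanSemifield
  | zero, b => b
  | one, _ => one

/-- Multiplication is the minimum. -/
def mul : BooleanSemifield → BooleanSemifield → BooleanSemifield
  | zero, _ => zero
  | one, b => b

instance : Zero BooleanSemifield := ⟨zero⟩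

instance : One BooleanSemifield := ⟨one⟩

instance : Add BooleanSemifield := ⟨add⟩

instance : Mul BooleanSemifield := ⟨mul⟩

instance : CommSemiring BooleanSemifield where
  nsmul := nsmulRec
  npow := npowRec
  add_assoc := by rintro ⟨⟩ ⟨⟩ ⟨⟩ <;> rfl
  zero_add := by rintro ⟨⟩ <;> rfl
  add_zero := by rintro ⟨⟩ <;> rfl
  add_comm := by rintro ⟨⟩ ⟨⟩ <;> rfl
  left_distrib := by rintro ⟨⟩ ⟨⟩ ⟨⟩ <;> rfl
  right_distrib := by rintro ⟨⟩ ⟨⟩ ⟨⟩ <;> rfl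
  zero_mul := by rintro ⟨⟩ <;> rfl
  mul_zero := by rintro ⟨⟩ <;> rfl
  mul_assoc := by rintro ⟨⟩ ⟨⟩ ⟨⟩ <;> rfl
  one_mul := by rintro ⟨⟩ <;> rfl
  mul_one := by rintro ⟨⟩ <;> rfl
  mul_comm := by rintro ⟨⟩ ⟨⟩ <;> rfl

end BooleanSemifield

end LeavittPath

/-! Sufficiency. Let a nontrivial congruence relate `a ≠ b`. Multiplying on the right by a long
enough path (or any path into a sink) removes all ghost edges, and relation (iv) ensures that some
such path keeps the two elements distinct. Both are then combinations of paths ending at one vertex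
`x`, and some path `p` has different coefficients `c ≠ d`. Left multiplication by `p*` turns `p`
into `x` and every other term into 0, a path or a ghost path of positive length. Exits of cycles
allow these terms to be killed by two-sided multiplication, leaving `c y ~ d y` for a vertex `y`
(`exists_smul_vertex_rel`). Over a field or the Boolean semifield an affine map sends `c, d` to 1
and 0 in some order, so `y ~ 0`. The vertices related to 0 form a hereditary saturated set, which
must be all of `V` (`eq_top_of_vertex_rel_zero`).

Necessity. A branching system yields a representation on finitely supported functions with values in
any `S`-module `T`. If the system and `T` are nontrivial, its kernel congruence is not universal, so
simplicity makes the representation faithful. Three choices give the three conditions: `T = S/ρ`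
shows that `S` is congruence-simple; a system with empty fibres over `H` kills the vertices of `H`;
and a system on which an exitless cycle acts as its base vertex contradicts the grading by length.
Finally, a congruence-simple commutative semiring is a field or Boolean
(`field_or_boolean_of_simple`). -/

namespace LeavittPath

universe u v w

/-! ### The presented algebra: relations, universal property, local units -/

section Basic

variable (S : Type w) [CommSemiring S] {V : Type u} {E : Type v} (Γ : DirectedGraph V E)

/-- The image of a generator in the Leavitt path algebra. -/
noncomputable def mkGen (g : Gen V E) : LeavittPathAlgebra S Γ := ((gen S g : FreeAlg S V E) :)

/-- The vertex `x` in the Leavitt path algebra. -/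
noncomputable abbrev vertex (x : V) : LeavittPathAlgebra S Γ := mkGen S Γ (Gen.vertex x)

/-- The edge `e` in the Leavitt path algebra. -/
noncomputable abbrev edge (e : E) : LeavittPathAlgebra S Γ := mkGen S Γ (Gen.edge e)

/-- The ghost edge `e*` in the Leavitt path algebra. -/
noncomputable abbrev ghost (e : E) : LeavittPathAlgebra S Γ := mkGen S Γ (Gen.ghost e)

variable {S Γ} in
theorem mk_eq_of_rel {a b : FreeAlg S V E} (h : Rel S Γ a b) :
    (a : LeavittPathAlgebra S Γ) = b :=
  (RingCon.eq _).2 <| RingConGen.Rel.of _ _ ⟨1, a, b, h, (one_smul _ _).symm, (one_smul _ _).symm⟩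

theorem vertex_mul_self (x : V) : vertex S Γ x * vertex S Γ x = vertex S Γ x :=
  mk_eq_of_rel (.vertex_self x)

variable {Γ} in
theorem vertex_mul_of_ne {x y : V} (h : x ≠ y) : vertex S Γ x * vertex S Γ y = 0 :=
  mk_eq_of_rel (.vertex_ne x y h)

theorem source_mul_edge (e : E) : vertex S Γ (Γ.s e) * edge S Γ e = edge S Γ e :=
  mk_eq_of_rel (.source_edge e)

theorem edge_mul_range (e : E) : edge S Γ e * vertex S Γ (Γ.r e) = edge S Γ e :=
  mk_eq_of_rel (.edge_range e)

theorem range_mul_ghost (e : E) : vertex S Γ (Γ.r e) * ghost S Γ e = ghost S Γ e :=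
  mk_eq_of_rel (.range_ghost e)

theorem ghost_mul_source (e : E) : ghost S Γ e * vertex S Γ (Γ.s e) = ghost S Γ e :=
  mk_eq_of_rel (.ghost_source e)

theorem ghost_mul_edge_self (e : E) : ghost S Γ e * edge S Γ e = vertex S Γ (Γ.r e) :=
  mk_eq_of_rel (.ghost_edge_self e)

variable {Γ} in
theorem ghost_mul_edge_of_ne {e f : E} (h : e ≠ f) : ghost S Γ e * edge S Γ f = 0 :=
  mk_eq_of_rel (.ghost_edge_ne e f h)

variable {Γ} in
theorem vertex_eq_sum {x : V} (h : Γ.IsRegular x) :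
    vertex S Γ x = ∑ e ∈ h.2.toFinset, edge S Γ e * ghost S Γ e := by
  refine (mk_eq_of_rel (.regular x h)).trans ?_
  classical
  induction h.2.toFinset using Finset.induction_on with
  | empty => rfl
  | insert e s he ih => rw [Finset.sum_insert he, Finset.sum_insert he, ← ih]; rfl

variable {S Γ} in
@[elab_as_elim]
theorem LeavittPathAlgebra.induction {P : LeavittPathAlgebra S Γ → Prop}
    (zero : P 0) (add : ∀ x y, P x → P y → P (x + y)) (smul : ∀ (c : S) x, P x → P (c • x))
    (gen : ∀ g, P (mkGen S Γ g)) (gen_mul : ∀ g x, P x → P (mkGen S Γ g * x))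
    (x : LeavittPathAlgebra S Γ) : P x := by
  obtain ⟨x⟩ := x
  change P (x : LeavittPathAlgebra S Γ)
  induction x using MonoidAlgebra.induction_linear with
  | zero => exact zero
  | add x y hx hy => exact add _ _ hx hy
  | single w c =>
    have h : P ((MonoidAlgebra.single w (1 : S) : FreeAlg S V E) : LeavittPathAlgebra S Γ) := by
      induction w using FreeSemigroup.recOnMul with
      | ih1 g => exact gen g
      | ih2 g w _ hw =>
        have := gen_mul g _ hw
        rwa [mkGen, ← RingCon.coe_mul, LeavittPath.gen, MonoidAlgebra.single_mul_single,
          mul_one] at this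
    have := smul c _ h
    change P ((c • MonoidAlgebra.single w (1 : S) : FreeAlg S V E) : LeavittPathAlgebra S Γ) at this
    rwa [MonoidAlgebra.smul_single, smul_eq_mul, mul_one] at this

section Lift

variable {S Γ} {A : Type*} [NonUnitalSemiring A] [Module S A] [IsScalarTower S A A]
  [SMulCommClass S A A]

/-- The homomorphism from the free algebra with the given values on the generators. -/
noncomputable def freeLift (f : Gen V E → A) : FreeAlg S V E →ₙₐ[S] A :=
  MonoidAlgebra.liftMagma S (FreeSemigroup.lift f)

theorem freeLift_gen (f : Gen V E → A) (g : Gen V E) : freeLift f (gen S g) = f g := by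
  simp [freeLift, gen, MonoidAlgebra.liftMagma, FreeSemigroup.lift_of]

/-- The homomorphism from the Leavitt path algebra with the given values on the generators. -/
noncomputable def lift (f : Gen V E → A)
    (hf : ∀ a b : FreeAlg S V E, Rel S Γ a b → freeLift f a = freeLift f b) :
    LeavittPathAlgebra S Γ →ₙₐ[S] A :=
  have h : ∀ a b, con S Γ a b → freeLift f a = freeLift f b := fun a b hab => by
    change RingConGen.Rel _ a b at hab
    induction hab with
    | of x y h =>
      obtain ⟨c, a, b, hab, rfl, rfl⟩ := h
      rw [map_smul, map_smul, hf a b hab]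
    | refl => rfl
    | symm _ ih => exact ih.symm
    | trans _ _ ih₁ ih₂ => exact ih₁.trans ih₂
    | add _ _ ih₁ ih₂ => rw [map_add, map_add, ih₁, ih₂]
    | mul _ _ ih₁ ih₂ => rw [map_mul, map_mul, ih₁, ih₂]
  { toFun := Quotient.lift (freeLift f) h
    map_smul' := by
      rintro c ⟨x⟩
      exact map_smul (freeLift f) c x
    map_zero' := map_zero (freeLift (S := S) f)
    map_add' := by
      rintro ⟨x⟩ ⟨y⟩
      exact map_add (freeLift f) x y
    map_mul' := by
      rintro ⟨x⟩ ⟨y⟩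
      exact map_mul (freeLift f) x y }

theorem lift_mkGen (f : Gen V E → A)
    (hf : ∀ a b : FreeAlg S V E, Rel S Γ a b → freeLift f a = freeLift f b) (g : Gen V E) :
    lift f hf (mkGen S Γ g) = f g :=
  freeLift_gen f g

end Lift

/-- A congruence is trivial on the whole algebra as soon as it identifies all vertices with `0`. -/
theorem eq_top_of_forall_vertex (ρ : RingCon (LeavittPathAlgebra S Γ))
    (h : ∀ x, ρ (vertex S Γ x) 0) : ρ = ⊤ := by
  have key : ∀ x, ρ x 0 := by
    have hgen : ∀ g, ρ (mkGen S Γ g) 0 := by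
      rintro (x | e | e)
      · exact h x
      · simpa only [edge_mul_range, mul_zero] using ρ.mul (ρ.refl (edge S Γ e)) (h (Γ.r e))
      · simpa only [ghost_mul_source, mul_zero] using ρ.mul (ρ.refl (ghost S Γ e)) (h (Γ.s e))
    have hloc : ∀ g, ∃ x, vertex S Γ x * mkGen S Γ g = mkGen S Γ g := by
      rintro (x | e | e)
      · exact ⟨x, vertex_mul_self S Γ x⟩
      · exact ⟨_, source_mul_edge S Γ e⟩
      · exact ⟨_, range_mul_ghost S Γ e⟩
    intro x
    -- `ρ` is not assumed compatible with scalars, so the scalar is built into the induction; on a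
    -- generator it is absorbed by a local unit, `c • g = (c • x) * g`.
    suffices H : ∀ c : S, ρ (c • x) 0 by simpa using H 1
    refine LeavittPathAlgebra.induction (P := fun x => ∀ c : S, ρ (c • x) 0)
      ?_ ?_ ?_ ?_ ?_ x
    · intro c
      rw [smul_zero]
      exact ρ.refl 0
    · intro x y hx hy c
      simpa using ρ.add (hx c) (hy c)
    · intro d x hx c
      rw [smul_smul]
      exact hx _
    · intro g c
      obtain ⟨x, hx⟩ := hloc g
      have := ρ.mul (ρ.refl (c • vertex S Γ x)) (hgen g)
      rwa [smul_mul_assoc, hx, mul_zero] at this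
    · intro g x hx c
      have := ρ.mul (ρ.refl (mkGen S Γ g)) (hx c)
      rwa [mul_smul_comm, mul_zero] at this
  refine eq_top_iff.2 fun {x y} _ => ρ.trans (key x) (ρ.symm (key y))

/-- Every element is fixed by right multiplication with all large finite sums of vertices. -/
theorem exists_mul_sum_vertex (a : LeavittPathAlgebra S Γ) :
    ∃ F : Finset V, ∀ F', F ⊆ F' → a * ∑ x ∈ F', vertex S Γ x = a := by
  classical
  have hv : ∀ (b : LeavittPathAlgebra S Γ) x, b * vertex S Γ x = b →
      ∀ F' : Finset V, x ∈ F' → b * ∑ y ∈ F', vertex S Γ y = b := by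
    intro b x hb F' hx
    rw [← hb, mul_assoc, Finset.mul_sum, Finset.sum_eq_single_of_mem x hx, vertex_mul_self]
    exact fun y _ hy => vertex_mul_of_ne S hy.symm
  induction a using LeavittPathAlgebra.induction with
  | zero => exact ⟨∅, fun _ _ => zero_mul _⟩
  | add a b ha hb =>
    obtain ⟨F, hF⟩ := ha
    obtain ⟨G, hG⟩ := hb
    refine ⟨F ∪ G, fun F' h => ?_⟩
    rw [add_mul, hF _ (Finset.union_subset_left h), hG _ (Finset.union_subset_right h)]
  | smul c a ha =>
    obtain ⟨F, hF⟩ := ha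
    exact ⟨F, fun F' h => by rw [smul_mul_assoc, hF _ h]⟩
  | gen g =>
    have : ∃ x, mkGen S Γ g * vertex S Γ x = mkGen S Γ g := by
      rcases g with (x | e | e)
      · exact ⟨x, vertex_mul_self S Γ x⟩
      · exact ⟨_, edge_mul_range S Γ e⟩
      · exact ⟨_, ghost_mul_source S Γ e⟩
    obtain ⟨x, hx⟩ := this
    exact ⟨{x}, fun F' h => hv _ x hx _ (Finset.singleton_subset_iff.1 h)⟩
  | gen_mul g a ha =>
    obtain ⟨F, hF⟩ := ha
    exact ⟨F, fun F' h => by rw [mul_assoc, hF _ h]⟩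

variable {S Γ} in
theorem ext_mul_vertex {a b : LeavittPathAlgebra S Γ}
    (h : ∀ x, a * vertex S Γ x = b * vertex S Γ x) : a = b := by
  classical
  obtain ⟨F, hF⟩ := exists_mul_sum_vertex S Γ a
  obtain ⟨G, hG⟩ := exists_mul_sum_vertex S Γ b
  rw [← hF _ Finset.subset_union_left, ← hG _ (Finset.subset_union_right (s₁ := F)),
    Finset.mul_sum, Finset.mul_sum]
  exact Finset.sum_congr rfl fun x _ => h x

end Basic

/-! ### Paths, and exits of closed paths -/

namespace DirectedGraph

variable {V : Type u} {E : Type v} (Γ : DirectedGraph V E)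

/-- The list `l` of edges is a path from `x` to `y`. -/
def IsPath : List E → V → V → Prop
  | [], x, y => x = y
  | e :: l, x, y => Γ.s e = x ∧ IsPath l (Γ.r e) y

variable {Γ}

theorem isPath_append {l m : List E} {x y : V} :
    Γ.IsPath (l ++ m) x y ↔ ∃ z, Γ.IsPath l x z ∧ Γ.IsPath m z y := by
  induction l generalizing x with
  | nil => simp [IsPath]
  | cons e l ih => simp [IsPath, ih, and_assoc]

theorem IsPath.isChain {l : List E} {x y : V} (h : Γ.IsPath l x y) :
    l.IsChain fun e f => Γ.r e = Γ.s f := by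
  induction l generalizing x with
  | nil => exact .nil
  | cons e l ih =>
    cases l with
    | nil => exact .singleton _
    | cons f l => exact .cons_cons h.2.1.symm (ih h.2)

theorem IsPath.source_head {l : List E} {x y : V} (h : Γ.IsPath l x y) (hl : l ≠ []) :
    Γ.s (l.head hl) = x := by
  cases l with
  | nil => exact absurd rfl hl
  | cons e l => exact h.1

theorem IsPath.range_getLast {l : List E} {x y : V} (h : Γ.IsPath l x y) (hl : l ≠ []) :
    Γ.r (l.getLast hl) = y := by
  induction l generalizing x with
  | nil => exact absurd rfl hl
  | cons e l ih =>
    cases l with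
    | nil => exact h.2
    | cons f l => exact ih h.2 (List.cons_ne_nil f l)

theorem isPath_of_isChain {l : List E} (hl : l ≠ [])
    (h : l.IsChain fun e f => Γ.r e = Γ.s f) :
    Γ.IsPath l (Γ.s (l.head hl)) (Γ.r (l.getLast hl)) := by
  induction l with
  | nil => exact absurd rfl hl
  | cons e l ih =>
    cases l with
    | nil => exact ⟨rfl, rfl⟩
    | cons f l =>
      rw [List.isChain_cons_cons] at h
      refine ⟨rfl, ?_⟩
      rw [h.1]
      exact ih (List.cons_ne_nil f l) h.2

theorem IsCycle.isPath {p : List E} (h : Γ.IsCycle p) :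
    Γ.IsPath p (Γ.s (p.head h.ne_nil)) (Γ.s (p.head h.ne_nil)) := by
  simpa only [h.closed] using isPath_of_isChain h.ne_nil h.chain

/-- If all cycles have exits, then so do all closed paths. -/
theorem exists_isExit_of_isPath (hΓ : ∀ p, Γ.IsCycle p → ∃ f, Γ.IsExit f p) {l : List E}
    (hl : l ≠ []) {x : V} (h : Γ.IsPath l x x) : ∃ f, Γ.IsExit f l := by
  induction hn : l.length using Nat.strong_induction_on generalizing l x with
  | _ n ih =>
    subst hn
    by_cases hnd : (l.map Γ.s).Nodup
    · exact hΓ l ⟨hl, h.isChain, (h.range_getLast hl).trans (h.source_head hl).symm, hnd⟩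
    · rw [List.nodup_iff_forall_not_duplicate] at hnd
      push Not at hnd
      obtain ⟨y, hy⟩ := hnd
      -- A repeated source `y` exhibits a segment `e :: b₁` of `l` that leaves `y` and returns to
      -- it. This is a shorter closed path, and any exit of a segment is an exit of the whole path.
      obtain ⟨a, b, hab⟩ : ∃ a b : List E, l = a ++ b ∧ ∃ e b₁ b₂, b = e :: (b₁ ++ b₂) ∧
          Γ.s e = y ∧ ∃ f c, b₂ = f :: c ∧ Γ.s f = y := by
        clear ih hl h
        induction l with
        | nil => simp at hy
        | cons e l ihl =>
          rw [List.map_cons] at hy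
          by_cases hy' : (l.map Γ.s).Duplicate y
          · obtain ⟨a, b, rfl, H⟩ := ihl hy'
            exact ⟨e :: a, b, rfl, H⟩
          · have hye : y = Γ.s e := by
              by_contra hne
              exact hy' ((List.duplicate_cons_iff_of_ne hne).1 hy)
            subst hye
            have := List.duplicate_cons_self_iff.1 hy
            obtain ⟨f, hf, hfe⟩ := List.mem_map.1 this
            obtain ⟨b₁, c, rfl⟩ := List.append_of_mem hf
            exact ⟨[], _, rfl, e, b₁, f :: c, rfl, rfl, f, c, rfl, hfe⟩
      obtain ⟨rfl, e, b₁, _, rfl, rfl, f, c, rfl, hf⟩ := hab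
      obtain ⟨z, -, hez, h⟩ := isPath_append.1 h
      obtain ⟨t, h₁, hft, -⟩ := isPath_append.1 h
      have hloop : Γ.IsPath (e :: b₁) (Γ.s e) (Γ.s e) := ⟨rfl, by rwa [← hf, hft]⟩
      obtain ⟨g, e', he', hg⟩ := ih _ (by simp; omega) (List.cons_ne_nil _ _) hloop rfl
      refine ⟨g, e', ?_, hg⟩
      simp only [List.mem_append, List.mem_cons] at he' ⊢
      tauto

end DirectedGraph

/-! ### Products of paths and ghost paths; compression by exits -/

section Paths

variable (S : Type w) [CommSemiring S] {V : Type u} {E : Type v} (Γ : DirectedGraph V E)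

/-- The product of the edges in a list, followed by a vertex. It is `0` unless the list is a path
ending at this vertex. -/
noncomputable def path : List E → V → LeavittPathAlgebra S Γ
  | [], x => vertex S Γ x
  | e :: l, x => edge S Γ e * path l x

/-- The image of `path` under the involution that exchanges edges and ghost edges. -/
noncomputable def ghostPath : List E → V → LeavittPathAlgebra S Γ
  | [], x => vertex S Γ x
  | e :: l, x => ghostPath l x * ghost S Γ e

/-- The paths and ghost paths of positive length ending at `x`, and `0`. -/
def properPaths (x : V) : Set (LeavittPathAlgebra S Γ) :=
  {a | a = 0 ∨ ∃ l : List E, l ≠ [] ∧ (a = path S Γ l x ∨ a = ghostPath S Γ l x)}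

variable {S Γ}

theorem path_mul_vertex (l : List E) (x : V) : path S Γ l x * vertex S Γ x = path S Γ l x := by
  induction l with
  | nil => exact vertex_mul_self S Γ x
  | cons e l ih => rw [path, mul_assoc, ih]

theorem vertex_mul_ghostPath (l : List E) (x : V) :
    vertex S Γ x * ghostPath S Γ l x = ghostPath S Γ l x := by
  induction l with
  | nil => exact vertex_mul_self S Γ x
  | cons e l ih => rw [ghostPath, ← mul_assoc, ih]

theorem vertex_mul_edge (y : V) (e : E) :
    vertex S Γ y * edge S Γ e = edge S Γ e ∧ Γ.s e = y ∨ vertex S Γ y * edge S Γ e = 0 := by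
  by_cases h : Γ.s e = y
  · exact .inl ⟨h ▸ source_mul_edge S Γ e, h⟩
  · rw [← source_mul_edge, ← mul_assoc, vertex_mul_of_ne S (Ne.symm h), zero_mul]
    exact .inr rfl

theorem ghost_mul_vertex (y : V) (e : E) :
    ghost S Γ e * vertex S Γ y = ghost S Γ e ∧ Γ.s e = y ∨ ghost S Γ e * vertex S Γ y = 0 := by
  by_cases h : Γ.s e = y
  · exact .inl ⟨h ▸ ghost_mul_source S Γ e, h⟩
  · rw [← ghost_mul_source, mul_assoc, vertex_mul_of_ne S h, mul_zero]
    exact .inr rfl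

theorem vertex_mul_vertex (x y : V) :
    vertex S Γ x * vertex S Γ y = vertex S Γ y ∧ x = y ∨ vertex S Γ x * vertex S Γ y = 0 := by
  by_cases h : x = y
  · exact .inl ⟨h ▸ vertex_mul_self S Γ x, h⟩
  · exact .inr (vertex_mul_of_ne S h)

theorem vertex_mul_path (y : V) (l : List E) (x : V) :
    vertex S Γ y * path S Γ l x = path S Γ l x ∨ vertex S Γ y * path S Γ l x = 0 := by
  cases l with
  | nil => exact (vertex_mul_vertex y x).imp_left And.left
  | cons e l =>
    rw [path, ← mul_assoc]
    rcases vertex_mul_edge (S := S) (Γ := Γ) y e with ⟨h, -⟩ | h <;> simp [h]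

theorem ghostPath_mul_vertex (y : V) (l : List E) (x : V) :
    ghostPath S Γ l x * vertex S Γ y = ghostPath S Γ l x ∨
      ghostPath S Γ l x * vertex S Γ y = 0 := by
  cases l with
  | nil =>
    by_cases h : x = y
    · exact .inl (h ▸ vertex_mul_self S Γ x)
    · exact .inr (vertex_mul_of_ne S h)
  | cons e l =>
    rw [ghostPath, mul_assoc]
    rcases ghost_mul_vertex (S := S) (Γ := Γ) y e with ⟨h, -⟩ | h <;> simp [h]

theorem isPath_of_vertex_mul_path_ne_zero {y : V} {l : List E} {x : V}
    (h : vertex S Γ y * path S Γ l x ≠ 0) : Γ.IsPath l y x := by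
  induction l generalizing y with
  | nil => exact ((vertex_mul_vertex y x).resolve_right h).2
  | cons e l ih =>
    rw [path, ← mul_assoc] at h
    have h₁ := (vertex_mul_edge (S := S) (Γ := Γ) y e).resolve_right fun h0 => h (by
      rw [h0, zero_mul])
    refine ⟨h₁.2, ih fun h0 => h ?_⟩
    rw [h₁.1, ← edge_mul_range, mul_assoc, h0, mul_zero]

theorem isPath_of_ghostPath_mul_vertex_ne_zero {y : V} {l : List E} {x : V}
    (h : ghostPath S Γ l x * vertex S Γ y ≠ 0) : Γ.IsPath l y x := by
  induction l generalizing y with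
  | nil => exact ((vertex_mul_vertex x y).resolve_right h).2.symm
  | cons e l ih =>
    rw [ghostPath, mul_assoc] at h
    have h₁ := (ghost_mul_vertex (S := S) (Γ := Γ) y e).resolve_right fun h0 => h (by
      rw [h0, mul_zero])
    refine ⟨h₁.2, ih fun h0 => h ?_⟩
    rw [h₁.1, ← range_mul_ghost, ← mul_assoc, h0, zero_mul]

theorem vertex_mul_path_of_isPath {l : List E} {x y : V} (h : Γ.IsPath l y x) :
    vertex S Γ y * path S Γ l x = path S Γ l x := by
  cases l with
  | nil =>
    obtain rfl : y = x := h
    exact vertex_mul_self S Γ y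
  | cons e l => rw [path, ← h.1, ← mul_assoc, source_mul_edge]

theorem ghostPath_mul_vertex_of_isPath {l : List E} {x y : V} (h : Γ.IsPath l y x) :
    ghostPath S Γ l x * vertex S Γ y = ghostPath S Γ l x := by
  cases l with
  | nil =>
    obtain rfl : y = x := h
    exact vertex_mul_self S Γ y
  | cons e l => rw [ghostPath, ← h.1, mul_assoc, ghost_mul_source]

theorem path_append {l m : List E} {x y : V} (h : Γ.IsPath m y x) :
    path S Γ (l ++ m) x = path S Γ l y * path S Γ m x := by
  induction l with
  | nil => exact (vertex_mul_path_of_isPath h).symm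
  | cons e l ih => rw [List.cons_append, path, ih, path, mul_assoc]

theorem ghostPath_append {l m : List E} {x y : V} (h : Γ.IsPath m y x) :
    ghostPath S Γ (l ++ m) x = ghostPath S Γ m x * ghostPath S Γ l y := by
  induction l with
  | nil => exact (ghostPath_mul_vertex_of_isPath h).symm
  | cons e l ih => rw [List.cons_append, ghostPath, ih, ghostPath, mul_assoc]

theorem path_singleton (e : E) : path S Γ [e] (Γ.r e) = edge S Γ e :=
  edge_mul_range S Γ e

theorem ghostPath_singleton (e : E) : ghostPath S Γ [e] (Γ.r e) = ghost S Γ e :=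
  range_mul_ghost S Γ e

theorem isPath_singleton (e : E) : Γ.IsPath [e] (Γ.s e) (Γ.r e) := ⟨rfl, rfl⟩

theorem ghostPath_mul_path_self (l : List E) (x : V) :
    ghostPath S Γ l x * path S Γ l x = vertex S Γ x ∨ path S Γ l x = 0 := by
  induction l with
  | nil => exact .inl (vertex_mul_self S Γ x)
  | cons e l ih =>
    rw [ghostPath, path, ← mul_assoc, mul_assoc (ghostPath S Γ l x), ghost_mul_edge_self,
      mul_assoc]
    rcases vertex_mul_path (S := S) (Γ := Γ) (Γ.r e) l x with h | h
    · rw [h]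
      exact ih.imp_right fun h => by rw [h, mul_zero]
    · right
      rw [← edge_mul_range, mul_assoc, h, mul_zero]

theorem ghostPath_mul_path_self_of_isPath {l : List E} {x y : V} (h : Γ.IsPath l y x) :
    ghostPath S Γ l x * path S Γ l x = vertex S Γ x := by
  induction l generalizing y with
  | nil => exact vertex_mul_self S Γ x
  | cons e l ih =>
    rw [ghostPath, path, ← mul_assoc, mul_assoc (ghostPath S Γ l x), ghost_mul_edge_self,
      mul_assoc, vertex_mul_path_of_isPath h.2, ih h.2]

/-- Equal initial edges cancel in the middle through `e* e = r(e)`, and a mismatch gives 0. Since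
the lists differ, they cannot both be exhausted, so what survives has positive length. -/
theorem ghostPath_mul_path_mem {l m : List E} (h : l ≠ m) (x : V) :
    ghostPath S Γ l x * path S Γ m x ∈ properPaths S Γ x := by
  induction l generalizing m with
  | nil =>
    refine (vertex_mul_path x m x).elim (fun h0 => .inr ⟨m, h.symm, .inl h0⟩) .inl
  | cons e l ih =>
    cases m with
    | nil => exact (ghostPath_mul_vertex x (e :: l) x).elim (fun h0 => .inr ⟨_, h, .inr h0⟩) .inl
    | cons f m =>
      rw [ghostPath, path, ← mul_assoc, mul_assoc (ghostPath S Γ l x)]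
      by_cases hef : e = f
      · subst hef
        rw [ghost_mul_edge_self, mul_assoc]
        rcases vertex_mul_path (S := S) (Γ := Γ) (Γ.r e) m x with h0 | h0
        · rw [h0]
          exact ih fun hlm => h (hlm ▸ rfl)
        · exact .inl (by rw [h0, mul_zero])
      · exact .inl (by rw [ghost_mul_edge_of_ne S hef, mul_zero, zero_mul])

/-- If all cycles have exits, then any proper path can be killed by a compression that maps the
vertex `x` to a vertex and proper paths to proper paths. -/
theorem exists_compression (hΓ : ∀ p, Γ.IsCycle p → ∃ f, Γ.IsExit f p) {x : V}
    {a : LeavittPathAlgebra S Γ} (ha : a ∈ properPaths S Γ x) :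
    ∃ (y : V) (b c : LeavittPathAlgebra S Γ), b * vertex S Γ x * c = vertex S Γ y ∧
      b * a * c = 0 ∧ ∀ d ∈ properPaths S Γ x, b * d * c ∈ properPaths S Γ y := by
  -- Conjugation by `x` alone suffices for anything that is not a closed path or ghost path at `x`.
  have triv : vertex S Γ x * a * vertex S Γ x = 0 →
      ∃ (y : V) (b c : LeavittPathAlgebra S Γ), b * vertex S Γ x * c = vertex S Γ y ∧
      b * a * c = 0 ∧ ∀ d ∈ properPaths S Γ x, b * d * c ∈ properPaths S Γ y := by
    intro h0
    refine ⟨x, vertex S Γ x, vertex S Γ x, by rw [vertex_mul_self, vertex_mul_self], h0, ?_⟩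
    rintro d (rfl | ⟨l, hl, rfl | rfl⟩)
    · exact .inl (by rw [mul_zero, zero_mul])
    · rw [mul_assoc, path_mul_vertex]
      exact (vertex_mul_path x l x).elim (fun h => .inr ⟨l, hl, .inl h⟩) .inl
    · rw [vertex_mul_ghostPath]
      exact (ghostPath_mul_vertex x l x).elim (fun h => .inr ⟨l, hl, .inr h⟩) .inl
  have main : ∀ l : List E, l ≠ [] → Γ.IsPath l x x →
      ∃ (y : V) (b c : LeavittPathAlgebra S Γ), b * vertex S Γ x * c = vertex S Γ y ∧
      (b * path S Γ l x * c = 0 ∧ b * ghostPath S Γ l x * c = 0) ∧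
      ∀ d ∈ properPaths S Γ x, b * d * c ∈ properPaths S Γ y := by
    intro l hl hlx
    obtain ⟨f, e, he, hfe, hne⟩ := DirectedGraph.exists_isExit_of_isPath hΓ hl hlx
    obtain ⟨m, n, rfl⟩ := List.append_of_mem he
    obtain ⟨z, hm, rfl, hn⟩ := DirectedGraph.isPath_append.1 hlx
    have hγ : Γ.IsPath (m ++ [f]) x (Γ.r f) :=
      DirectedGraph.isPath_append.2 ⟨_, hm, hfe, rfl⟩
    have hen : Γ.IsPath (e :: n) (Γ.s e) x := ⟨rfl, hn⟩
    have hf : Γ.IsPath [f] (Γ.s e) (Γ.r f) := ⟨hfe, rfl⟩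
    -- With `γ = m f` following the closed path `m e n` up to the exit, `γ* γ = r(f)`, while `f* e =
    -- 0 = e* f` kills both the closed path and its ghost. For a further path `k` of positive
    -- length, `γ* k γ` is proper because `k γ ≠ γ`.
    refine ⟨Γ.r f, ghostPath S Γ (m ++ [f]) (Γ.r f), path S Γ (m ++ [f]) (Γ.r f), ?_, ⟨?_, ?_⟩, ?_⟩
    · rw [ghostPath_mul_vertex_of_isPath hγ, ghostPath_mul_path_self_of_isPath hγ]
    · have : ghostPath S Γ (m ++ [f]) (Γ.r f) * path S Γ (m ++ e :: n) x = 0 := by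
        rw [path_append hen, ghostPath_append hf, mul_assoc, ← mul_assoc (ghostPath S Γ m _),
          ghostPath_mul_path_self_of_isPath hm, vertex_mul_path_of_isPath hen,
          ghostPath_singleton, path, ← mul_assoc, ghost_mul_edge_of_ne S hne, zero_mul]
      rw [this, zero_mul]
    · have : ghostPath S Γ (m ++ e :: n) x * path S Γ (m ++ [f]) (Γ.r f) = 0 := by
        rw [path_append hf, ghostPath_append hen, mul_assoc, ← mul_assoc (ghostPath S Γ m _),
          ghostPath_mul_path_self_of_isPath hm, vertex_mul_path_of_isPath hf,
          path_singleton, ghostPath, mul_assoc, ghost_mul_edge_of_ne S hne.symm, mul_zero]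
      rw [mul_assoc, this, mul_zero]
    · rintro d (rfl | ⟨k, hk, rfl | rfl⟩)
      · exact .inl (by rw [mul_zero, zero_mul])
      · rw [mul_assoc, ← path_append hγ]
        exact ghostPath_mul_path_mem (fun h => hk (List.self_eq_append_left.1 h)) _
      · rw [← ghostPath_append hγ]
        exact ghostPath_mul_path_mem (fun h => hk (List.self_eq_append_left.1 h.symm)) _
  obtain rfl | ⟨l, hl, hal⟩ := ha
  · exact triv (by rw [mul_zero, zero_mul])
  by_cases hlx : Γ.IsPath l x x
  · obtain ⟨y, b, c, h₁, ⟨h₂, h₃⟩, h₄⟩ := main l hl hlx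
    exact ⟨y, b, c, h₁, by rcases hal with rfl | rfl <;> assumption, h₄⟩
  · refine triv ?_
    rcases hal with rfl | rfl
    · rw [not_imp_comm.1 isPath_of_vertex_mul_path_ne_zero hlx, zero_mul]
    · rw [mul_assoc, not_imp_comm.1 isPath_of_ghostPath_mul_vertex_ne_zero hlx, mul_zero]

/-- Compressions compose: each one keeps the remaining terms proper or zero, so the terms can be
killed one at a time. -/
theorem exists_compression_finset (hΓ : ∀ p, Γ.IsCycle p → ∃ f, Γ.IsExit f p) {x : V}
    (F : Finset (LeavittPathAlgebra S Γ)) (hF : ∀ a ∈ F, a ∈ properPaths S Γ x) :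
    ∃ (y : V) (b c : LeavittPathAlgebra S Γ), b * vertex S Γ x * c = vertex S Γ y ∧
      (∀ a ∈ F, b * a * c = 0) ∧ ∀ d ∈ properPaths S Γ x, b * d * c ∈ properPaths S Γ y := by
  classical
  induction F using Finset.induction_on with
  | empty =>
    obtain ⟨y, b, c, h₁, -, h₂⟩ := exists_compression hΓ (x := x) (S := S) (a := 0) (.inl rfl)
    exact ⟨y, b, c, h₁, by simp, h₂⟩
  | insert a F _ ih =>
    obtain ⟨y, b, c, h₁, h₂, h₃⟩ := ih fun a h => hF a (Finset.mem_insert_of_mem h)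
    obtain ⟨z, b', c', h₁', h₂', h₃'⟩ :=
      exists_compression hΓ (h₃ a (hF a (Finset.mem_insert_self a F)))
    have assoc : ∀ d, b' * b * d * (c * c') = b' * (b * d * c) * c' := by
      intro d
      simp only [mul_assoc]
    refine ⟨z, b' * b, c * c', by rw [assoc, h₁, h₁'], fun d hd => ?_, fun d hd => ?_⟩
    · rw [assoc]
      rcases Finset.mem_insert.1 hd with rfl | hd
      · exact h₂'
      · rw [h₂ d hd, mul_zero, zero_mul]
    · rw [assoc]
      exact h₃' _ (h₃ d hd)

end Paths

/-! ### Sufficiency: reducing a nontrivial congruence to a vertex -/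

section Reduction

variable (S : Type w) [CommSemiring S] {V : Type u} {E : Type v} (Γ : DirectedGraph V E)

/-- The span of all paths ending at `x` that have length at least `n`; there is no condition on the
length if `x` is a sink. -/
noncomputable def longPaths (n : ℕ) (x : V) : Submodule S (LeavittPathAlgebra S Γ) :=
  Submodule.span S {a | ∃ l : List E, a = path S Γ l x ∧ (n ≤ l.length ∨ ∀ e, Γ.s e ≠ x)}

variable {S Γ}

theorem path_mem_longPaths {n : ℕ} {x : V} {l : List E} (h : n ≤ l.length ∨ ∀ e, Γ.s e ≠ x) :
    path S Γ l x ∈ longPaths S Γ n x :=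
  Submodule.subset_span ⟨l, rfl, h⟩

/-- A generator shortens a path by at most one edge. Only a ghost edge meeting a path of length 0
could leave the span, and at a sink that product is 0, which is why sinks carry no length condition.
-/
theorem mkGen_mul_mem_longPaths (g : Gen V E) {n : ℕ} {x : V} {a : LeavittPathAlgebra S Γ}
    (ha : a ∈ longPaths S Γ (n + 1) x) : mkGen S Γ g * a ∈ longPaths S Γ n x := by
  induction ha using Submodule.span_induction with
  | zero => rw [mul_zero]; exact zero_mem _
  | add a b _ _ ha hb => rw [mul_add]; exact add_mem ha hb
  | smul c a _ ha => rw [mul_smul_comm]; exact Submodule.smul_mem _ _ ha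
  | mem a ha =>
    obtain ⟨l, rfl, hl⟩ := ha
    rcases g with (y | e | e)
    · rcases vertex_mul_path (S := S) (Γ := Γ) y l x with h | h
      · rw [h]
        exact path_mem_longPaths (hl.imp_left fun h => by omega)
      · rw [h]
        exact zero_mem _
    · exact path_mem_longPaths (l := e :: l) (hl.imp_left fun h => by simp; omega)
    · cases l with
      | nil =>
        have hl := hl.resolve_left (by simp)
        have : ghost S Γ e * path S Γ [] x = 0 :=
          (ghost_mul_vertex x e).resolve_left fun h => hl e h.2
        rw [this]
        exact zero_mem _
      | cons f l =>
        rw [path, ← mul_assoc]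
        by_cases hef : e = f
        · subst hef
          rw [ghost_mul_edge_self]
          rcases vertex_mul_path (S := S) (Γ := Γ) (Γ.r e) l x with h | h
          · rw [h]
            exact path_mem_longPaths (hl.imp_left fun h => by simpa using h)
          · rw [h]
            exact zero_mem _
        · rw [ghost_mul_edge_of_ne S hef, zero_mul]
          exact zero_mem _

/-- Multiplication by long paths on the right removes all ghost edges. -/
theorem exists_mul_path_mem_longPaths (a : LeavittPathAlgebra S Γ) :
    ∃ N : ℕ, ∀ (n : ℕ) (l : List E) (x : V), (n + N ≤ l.length ∨ ∀ e, Γ.s e ≠ x) →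
      a * path S Γ l x ∈ longPaths S Γ n x := by
  induction a using LeavittPathAlgebra.induction with
  | zero => exact ⟨0, fun n l x _ => by rw [zero_mul]; exact zero_mem _⟩
  | add a b ha hb =>
    obtain ⟨M, hM⟩ := ha
    obtain ⟨N, hN⟩ := hb
    refine ⟨max M N, fun n l x h => ?_⟩
    rw [add_mul]
    exact add_mem (hM n l x (h.imp_left fun h => by omega))
      (hN n l x (h.imp_left fun h => by omega))
  | smul c a ha =>
    obtain ⟨N, hN⟩ := ha
    exact ⟨N, fun n l x h => by
      rw [smul_mul_assoc]; exact Submodule.smul_mem _ _ (hN n l x h)⟩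
  | gen g => exact ⟨1, fun n l x h => mkGen_mul_mem_longPaths g (path_mem_longPaths h)⟩
  | gen_mul g a ha =>
    obtain ⟨N, hN⟩ := ha
    refine ⟨N + 1, fun n l x h => ?_⟩
    rw [mul_assoc]
    exact mkGen_mul_mem_longPaths g (hN (n + 1) l x (h.imp_left fun h => by omega))

theorem path_eq_sum {x : V} (hx : Γ.IsRegular x) (l : List E) :
    path S Γ l x = ∑ e ∈ hx.2.toFinset, path S Γ (l ++ [e]) (Γ.r e) * ghost S Γ e := by
  rw [← path_mul_vertex, vertex_eq_sum S hx, Finset.mul_sum]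
  refine Finset.sum_congr rfl fun e he => ?_
  obtain rfl : Γ.s e = x := by simpa using he
  rw [path_append (isPath_singleton e), path_singleton, mul_assoc]

/-- By relation (iv), a path ending at a regular vertex is `∑ (p e) e*`. Agreement on all one-edge
extensions would therefore force agreement on `p`, so a separating path can be lengthened until it
reaches a sink. -/
theorem exists_mul_path_ne (hΓ : Γ.RowFinite) {a b : LeavittPathAlgebra S Γ} (hab : a ≠ b)
    (N : ℕ) : ∃ (l : List E) (x : V), (N ≤ l.length ∨ ∀ e, Γ.s e ≠ x) ∧
      a * path S Γ l x ≠ b * path S Γ l x := by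
  induction N with
  | zero =>
    by_contra! h
    exact hab (ext_mul_vertex fun x => h [] x (.inl (Nat.zero_le _)))
  | succ N ih =>
    obtain ⟨l, x, hl, hne⟩ := ih
    by_cases hx : ∀ e, Γ.s e ≠ x
    · exact ⟨l, x, .inr hx, hne⟩
    · have hl := hl.resolve_right hx
      push Not at hx
      obtain ⟨f, hf⟩ := hx
      have hreg : Γ.IsRegular x := ⟨⟨f, hf⟩, hΓ x⟩
      by_contra! h
      refine hne ?_
      rw [path_eq_sum hreg, Finset.mul_sum, Finset.mul_sum]
      refine Finset.sum_congr rfl fun e _ => ?_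
      rw [← mul_assoc, ← mul_assoc, h (l ++ [e]) (Γ.r e) (.inl (by simpa using hl))]

/-- A nontrivial congruence identifies two different multiples of some vertex. -/
theorem exists_smul_vertex_rel (hΓ : Γ.RowFinite)
    (hcyc : ∀ p, Γ.IsCycle p → ∃ f, Γ.IsExit f p) (ρ : RingCon (LeavittPathAlgebra S Γ))
    (hρ : ρ ≠ ⊥) : ∃ (x : V) (c d : S), c ≠ d ∧ ρ (c • vertex S Γ x) (d • vertex S Γ x) := by
  classical
  obtain ⟨a, b, hρab, hab⟩ : ∃ a b, ρ a b ∧ a ≠ b := by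
    by_contra! h
    exact hρ (eq_bot_iff.2 fun {a b} hab => h a b hab)
  obtain ⟨M, hM⟩ := exists_mul_path_mem_longPaths a
  obtain ⟨N, hN⟩ := exists_mul_path_mem_longPaths b
  obtain ⟨q, x, hq, hne⟩ := exists_mul_path_ne hΓ hab (max M N)
  have hspan : ∀ a ∈ longPaths S Γ 0 x, ∃ c : List E →₀ S,
      (c.sum fun l k => k • path S Γ l x) = a := by
    intro a ha
    refine Finsupp.mem_span_range_iff_exists_finsupp.1 (Submodule.span_mono ?_ ha)
    rintro _ ⟨l, rfl, -⟩
    exact ⟨l, rfl⟩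
  obtain ⟨c, hc⟩ := hspan _ (hM 0 q x (hq.imp_left fun h => by omega))
  obtain ⟨d, hd⟩ := hspan _ (hN 0 q x (hq.imp_left fun h => by omega))
  have hρ' := ρ.mul hρab (ρ.refl (path S Γ q x))
  set F := c.support ∪ d.support
  rw [Finsupp.sum_of_support_subset c (s := F) Finset.subset_union_left
    (fun l k => k • path S Γ l x) (fun _ _ => zero_smul _ _)] at hc
  rw [Finsupp.sum_of_support_subset d (s := F) Finset.subset_union_right
    (fun l k => k • path S Γ l x) (fun _ _ => zero_smul _ _)] at hd
  rw [← hc, ← hd] at hρ' hne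
  -- Linear independence of paths is not needed: unequal sums have an unequal pair of terms, which
  -- gives both `c p ≠ d p` and `path S Γ p x ≠ 0`.
  obtain ⟨p, hpF, hp⟩ : ∃ p ∈ F, c p • path S Γ p x ≠ d p • path S Γ p x := by
    by_contra! h
    exact hne (Finset.sum_congr rfl h)
  obtain ⟨y, α, β, hv, hkill, -⟩ := exists_compression_finset hcyc (x := x)
    ((F.erase p).image fun l => ghostPath S Γ p x * path S Γ l x) (by
      intro a ha
      obtain ⟨l, hl, rfl⟩ := Finset.mem_image.1 ha
      exact ghostPath_mul_path_mem (Finset.ne_of_mem_erase hl).symm x)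
  have hpp : ghostPath S Γ p x * path S Γ p x = vertex S Γ x :=
    (ghostPath_mul_path_self p x).resolve_right fun h => hp (by rw [h, smul_zero, smul_zero])
  have hcompress : ∀ k : List E →₀ S,
      α * (ghostPath S Γ p x * ∑ l ∈ F, k l • path S Γ l x) * β = k p • vertex S Γ y := by
    intro k
    rw [Finset.mul_sum, Finset.mul_sum, Finset.sum_mul, Finset.sum_eq_single_of_mem p hpF]
    · rw [mul_smul_comm, mul_smul_comm, smul_mul_assoc, hpp, hv]
    · intro l hl hlp
      rw [mul_smul_comm, mul_smul_comm, smul_mul_assoc,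
        hkill _ (Finset.mem_image_of_mem _ (Finset.mem_erase.2 ⟨hlp, hl⟩)), smul_zero]
  have hfin := ρ.mul (ρ.mul (ρ.refl α) (ρ.mul (ρ.refl (ghostPath S Γ p x)) hρ')) (ρ.refl β)
  rw [hcompress, hcompress] at hfin
  exact ⟨y, c p, d p, fun h => hp (by rw [h]), hfin⟩

/-- The vertices related to 0 are hereditary because `r(e) = e* s(e) e`, and saturated because of
(iv) and `e e* = e r(e) e*`. -/
theorem eq_top_of_vertex_rel_zero
    (hH : ∀ H : Set V, Γ.Hereditary H → Γ.Saturated H → H = ∅ ∨ H = Set.univ)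
    (ρ : RingCon (LeavittPathAlgebra S Γ)) {x : V} (hx : ρ (vertex S Γ x) 0) : ρ = ⊤ := by
  have := hH {x | ρ (vertex S Γ x) 0} ?_ ?_
  · refine eq_top_of_forall_vertex S Γ ρ fun y => ?_
    rcases this with h | h
    · exact absurd (h ▸ hx : x ∈ (∅ : Set V)) (Set.notMem_empty x)
    · exact (h ▸ Set.mem_univ y : y ∈ {x | ρ (vertex S Γ x) 0})
  · intro e he
    have := ρ.mul (ρ.mul (ρ.refl (ghost S Γ e)) he) (ρ.refl (edge S Γ e))
    rwa [ghost_mul_source, ghost_mul_edge_self, mul_zero, zero_mul] at this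
  · intro y hy h
    change ρ _ _
    rw [vertex_eq_sum S hy]
    have : ∀ e ∈ hy.2.toFinset, ρ (edge S Γ e * ghost S Γ e) 0 := by
      intro e he
      have he : Γ.s e = y := by simpa using he
      have := ρ.mul (ρ.mul (ρ.refl (edge S Γ e)) (h e he)) (ρ.refl (ghost S Γ e))
      rwa [edge_mul_range, mul_zero, zero_mul] at this
    refine Finset.sum_induction _ (fun a => ρ a 0) (fun a b ha hb => ?_) (ρ.refl 0) this
    simpa using ρ.add ha hb

theorem congruenceSimple_of_scalars (hΓ : Γ.RowFinite)
    (hH : ∀ H : Set V, Γ.Hereditary H → Γ.Saturated H → H = ∅ ∨ H = Set.univ)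
    (hcyc : ∀ p, Γ.IsCycle p → ∃ f, Γ.IsExit f p)
    (hS : ∀ c d : S, c ≠ d → ∃ k m : S,
      k * (c + m) = 1 ∧ k * (d + m) = 0 ∨ k * (c + m) = 0 ∧ k * (d + m) = 1) :
    CongruenceSimple (LeavittPathAlgebra S Γ) := by
  intro ρ
  refine or_iff_not_imp_left.2 fun hρ => ?_
  obtain ⟨x, c, d, hcd, h⟩ := exists_smul_vertex_rel hΓ hcyc ρ hρ
  obtain ⟨k, m, hkm⟩ := hS c d hcd
  have h' := ρ.mul (ρ.refl (k • vertex S Γ x)) (ρ.add h (ρ.refl (m • vertex S Γ x)))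
  rw [← add_smul, ← add_smul, smul_mul_smul_comm, smul_mul_smul_comm, vertex_mul_self] at h'
  refine eq_top_of_vertex_rel_zero hH ρ (x := x) ?_
  rcases hkm with ⟨h₁, h₂⟩ | ⟨h₁, h₂⟩
  · rwa [h₁, h₂, one_smul, zero_smul] at h'
  · rw [h₁, h₂, one_smul, zero_smul] at h'
    exact ρ.symm h'

end Reduction

theorem BooleanSemifield.one_add_one : (1 + 1 : BooleanSemifield) = 1 := rfl

theorem BooleanSemifield.eq_zero_or_eq_one (a : BooleanSemifield) : a = 0 ∨ a = 1 := by
  cases a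
  · exact .inl rfl
  · exact .inr rfl

/-- Both orders must be allowed: affine maps of the Boolean semifield are monotone and cannot swap 0
and 1. -/
theorem exists_affine_of_field_or_boolean {S : Type*} [CommSemiring S]
    (h : (∃ F : Field S, F.toCommSemiring = ‹CommSemiring S›) ∨
      Nonempty (S ≃+* BooleanSemifield)) (c d : S) (hcd : c ≠ d) :
    ∃ k m : S, k * (c + m) = 1 ∧ k * (d + m) = 0 ∨ k * (c + m) = 0 ∧ k * (d + m) = 1 := by
  rcases h with ⟨F, rfl⟩ | ⟨⟨φ⟩⟩
  · refine ⟨(c - d)⁻¹, -d, .inl ⟨?_, ?_⟩⟩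
    · rw [← sub_eq_add_neg]
      exact inv_mul_cancel₀ (sub_ne_zero.2 hcd)
    · rw [add_neg_cancel, mul_zero]
  · have h01 : ∀ a : S, a = 0 ∨ a = 1 := fun a =>
      (BooleanSemifield.eq_zero_or_eq_one (φ a)).imp (fun h => φ.injective (by rw [h, map_zero]))
        (fun h => φ.injective (by rw [h, map_one]))
    refine ⟨1, 0, ?_⟩
    rcases h01 c with rfl | rfl <;> rcases h01 d with rfl | rfl <;> simp_all

/-! ### Branching systems and their representations -/

/-- A branching system of a graph: a set over the vertices, in which every point over a regular
vertex is uniquely obtained by prepending an edge to another point. -/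
structure BranchingSystem {V : Type u} {E : Type v} (Γ : DirectedGraph V E) (X : Type*) where
  base : X → V
  hd : X → Option E
  tl : X → X
  cons : E → X → X
  hd_cons : ∀ e x, base x = Γ.r e → hd (cons e x) = some e
  tl_cons : ∀ e x, base x = Γ.r e → tl (cons e x) = x
  base_cons : ∀ e x, base x = Γ.r e → base (cons e x) = Γ.s e
  source_hd : ∀ e x, hd x = some e → Γ.s e = base x
  base_tl : ∀ e x, hd x = some e → base (tl x) = Γ.r e
  cons_tl : ∀ e x, hd x = some e → cons e (tl x) = x
  hd_ne_none : ∀ x, Γ.IsRegular (base x) → hd x ≠ none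

section PartialMap

variable (S T : Type*) [CommSemiring S] [AddCommMonoid T] [Module S T] {X : Type*}

/-- The linear map induced by a partial map of the index set. -/
noncomputable def partialMap (f : X → Option X) : Module.End S (X →₀ T) :=
  Finsupp.lsum ℕ fun x => (f x).elim 0 Finsupp.lsingle

variable {S T}

theorem partialMap_of_some {f : X → Option X} {x y : X} (h : f x = some y) (t : T) :
    partialMap S T f (Finsupp.single x t) = Finsupp.single y t := by
  simp [partialMap, h]

theorem partialMap_of_none {f : X → Option X} {x : X} (h : f x = none) (t : T) :
    partialMap S T f (Finsupp.single x t) = 0 := by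
  simp [partialMap, h]

end PartialMap

namespace BranchingSystem

variable {V : Type u} {E : Type v} {Γ : DirectedGraph V E} {X : Type*} (B : BranchingSystem Γ X)

open Classical in
/-- The partial action of the generators on a branching system. -/
noncomputable def act : Gen V E → X → Option X
  | .vertex v, x => if B.base x = v then some x else none
  | .edge e, x => if B.base x = Γ.r e then some (B.cons e x) else none
  | .ghost e, x => if B.hd x = some e then some (B.tl x) else none

section Rep

variable (S T : Type*) [CommSemiring S] [AddCommMonoid T] [Module S T]

open Classical in
theorem partialMap_act_vertex (v : V) (x : X) (t : T) :
    partialMap S T (B.act (.vertex v)) (Finsupp.single x t) =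
      if B.base x = v then Finsupp.single x t else 0 := by
  split_ifs with h
  · exact partialMap_of_some (f := B.act (.vertex v)) (if_pos h) t
  · exact partialMap_of_none (f := B.act (.vertex v)) (if_neg h) t

open Classical in
theorem partialMap_act_edge (e : E) (x : X) (t : T) :
    partialMap S T (B.act (.edge e)) (Finsupp.single x t) =
      if B.base x = Γ.r e then Finsupp.single (B.cons e x) t else 0 := by
  split_ifs with h
  · exact partialMap_of_some (f := B.act (.edge e)) (if_pos h) t
  · exact partialMap_of_none (f := B.act (.edge e)) (if_neg h) t

open Classical in
theorem partialMap_act_ghost (e : E) (x : X) (t : T) :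
    partialMap S T (B.act (.ghost e)) (Finsupp.single x t) =
      if B.hd x = some e then Finsupp.single (B.tl x) t else 0 := by
  split_ifs with h
  · exact partialMap_of_some (f := B.act (.ghost e)) (if_pos h) t
  · exact partialMap_of_none (f := B.act (.ghost e)) (if_neg h) t

theorem freeLift_eq_of_rel (a b : FreeAlg S V E) (h : Rel S Γ a b) :
    freeLift (S := S) (fun g => partialMap S T (B.act g)) a =
      freeLift (S := S) (fun g => partialMap S T (B.act g)) b := by
  classical
  cases h with
  | vertex_self v =>
    rw [map_mul, freeLift_gen]
    refine Finsupp.lhom_ext fun x t => ?_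
    rw [Module.End.mul_apply, partialMap_act_vertex]
    split_ifs with h
    · rw [partialMap_act_vertex, if_pos h]
    · rw [map_zero]
  | vertex_ne v w hvw =>
    rw [map_mul, freeLift_gen, freeLift_gen, map_zero]
    refine Finsupp.lhom_ext fun x t => ?_
    rw [Module.End.mul_apply, partialMap_act_vertex]
    split_ifs with h
    · rw [partialMap_act_vertex, if_neg (fun h' => hvw (h'.symm.trans h)), LinearMap.zero_apply]
    · rw [map_zero, LinearMap.zero_apply]
  | source_edge e =>
    rw [map_mul, freeLift_gen, freeLift_gen]
    refine Finsupp.lhom_ext fun x t => ?_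
    rw [Module.End.mul_apply, partialMap_act_edge]
    split_ifs with h
    · rw [partialMap_act_vertex, if_pos (B.base_cons e x h)]
    · rw [map_zero]
  | edge_range e =>
    rw [map_mul, freeLift_gen, freeLift_gen]
    refine Finsupp.lhom_ext fun x t => ?_
    rw [Module.End.mul_apply, partialMap_act_vertex, partialMap_act_edge]
    split_ifs with h
    · rw [partialMap_act_edge, if_pos h]
    · rw [map_zero]
  | range_ghost e =>
    rw [map_mul, freeLift_gen, freeLift_gen]
    refine Finsupp.lhom_ext fun x t => ?_
    rw [Module.End.mul_apply, partialMap_act_ghost]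
    split_ifs with h
    · rw [partialMap_act_vertex, if_pos (B.base_tl e x h)]
    · rw [map_zero]
  | ghost_source e =>
    rw [map_mul, freeLift_gen, freeLift_gen]
    refine Finsupp.lhom_ext fun x t => ?_
    rw [Module.End.mul_apply, partialMap_act_vertex]
    split_ifs with h
    · rfl
    · rw [map_zero, partialMap_act_ghost, if_neg (fun h' => h (B.source_hd e x h').symm)]
  | ghost_edge_self e =>
    rw [map_mul, freeLift_gen, freeLift_gen, freeLift_gen]
    refine Finsupp.lhom_ext fun x t => ?_
    rw [Module.End.mul_apply, partialMap_act_edge, partialMap_act_vertex]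
    split_ifs with h
    · rw [partialMap_act_ghost, if_pos (B.hd_cons e x h), B.tl_cons e x h]
    · rw [map_zero]
  | ghost_edge_ne e f hef =>
    rw [map_mul, freeLift_gen, freeLift_gen, map_zero]
    refine Finsupp.lhom_ext fun x t => ?_
    rw [Module.End.mul_apply, partialMap_act_edge]
    split_ifs with h
    · rw [partialMap_act_ghost, B.hd_cons f x h,
        if_neg (fun h' => hef (Option.some_injective _ h').symm), LinearMap.zero_apply]
    · rw [map_zero, LinearMap.zero_apply]
  | regular v hv =>
    rw [map_sum]
    simp_rw [map_mul, freeLift_gen]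
    refine Finsupp.lhom_ext fun x t => ?_
    rw [LinearMap.sum_apply, partialMap_act_vertex]
    -- `e e*` projects onto the points with head `e`. Over a regular vertex each point has exactly
    -- one head, so exactly one summand survives.
    have hterm : ∀ e, (partialMap S T (B.act (.edge e)) * partialMap S T (B.act (.ghost e)))
        (Finsupp.single x t) = if B.hd x = some e then Finsupp.single x t else 0 := by
      intro e
      rw [Module.End.mul_apply, partialMap_act_ghost]
      split_ifs with h
      · rw [partialMap_act_edge, if_pos (B.base_tl e x h), B.cons_tl e x h]
      · rw [map_zero]
    simp_rw [hterm]
    split_ifs with h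
    · obtain ⟨e, he⟩ := Option.ne_none_iff_exists'.1 (B.hd_ne_none x (h ▸ hv))
      rw [Finset.sum_eq_single e, if_pos he]
      · intro f _ hf
        rw [if_neg]
        rw [he]
        exact fun h' => hf (Option.some_injective _ h').symm
      · intro hne
        exact absurd (by simpa [h] using B.source_hd e x he) hne
    · refine (Finset.sum_eq_zero fun e he => if_neg fun h' => h ?_).symm
      rw [← B.source_hd e x h']
      simpa using he

/-- The representation of the Leavitt path algebra given by a branching system. -/
noncomputable def rep : LeavittPathAlgebra S Γ →ₙₐ[S] Module.End S (X →₀ T) :=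
  lift (fun g => partialMap S T (B.act g)) (B.freeLift_eq_of_rel S T)

open Classical in
theorem rep_vertex (v : V) (x : X) (t : T) :
    B.rep S T (vertex S Γ v) (Finsupp.single x t) =
      if B.base x = v then Finsupp.single x t else 0 := by
  rw [rep, lift_mkGen, partialMap_act_vertex]

theorem base_foldr {l : List E} {v w : V} (h : Γ.IsPath l v w) {x : X} (hx : B.base x = w) :
    B.base (l.foldr B.cons x) = v := by
  induction l generalizing v with
  | nil => exact hx.trans h.symm
  | cons e l ih => exact (B.base_cons e _ (ih h.2)).trans h.1

theorem rep_path {l : List E} {v w : V} (h : Γ.IsPath l v w) {x : X} (hx : B.base x = w) (t : T) :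
    B.rep S T (path S Γ l w) (Finsupp.single x t) = Finsupp.single (l.foldr B.cons x) t := by
  classical
  induction l generalizing v with
  | nil => exact (B.rep_vertex S T w x t).trans (if_pos hx)
  | cons e l ih =>
    rw [path, map_mul, Module.End.mul_apply, ih h.2, rep, lift_mkGen, partialMap_act_edge,
      if_pos (B.base_foldr h.2 hx), List.foldr_cons]

/-- The congruence given by a branching system is not the universal one if the module of
coefficients is nontrivial. -/
theorem comap_rep_ne_top [Nontrivial T] [Nonempty X] : (⊥ : RingCon _).comap (B.rep S T) ≠ ⊤ := by
  classical
  intro h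
  obtain ⟨x⟩ := ‹Nonempty X›
  obtain ⟨t, ht⟩ := exists_ne (0 : T)
  have h0 : (⊥ : RingCon _).comap (B.rep S T) (vertex S Γ (B.base x)) 0 := h ▸ trivial
  have h1 : B.rep S T (vertex S Γ (B.base x)) = B.rep S T 0 := h0
  have h2 := B.rep_vertex S T (B.base x) x t
  rw [h1, map_zero, if_pos rfl, LinearMap.zero_apply, eq_comm, Finsupp.single_eq_zero] at h2
  exact ht h2

end Rep

/-- The product of a branching system with `ℤ`, where edges shift the degree by `1`. -/
def graded : BranchingSystem Γ (X × ℤ) where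
  base x := B.base x.1
  hd x := B.hd x.1
  tl x := (B.tl x.1, x.2 - 1)
  cons e x := (B.cons e x.1, x.2 + 1)
  hd_cons e x h := B.hd_cons e x.1 h
  tl_cons e x h := Prod.ext (B.tl_cons e x.1 h) (add_sub_cancel_right _ _)
  base_cons e x h := B.base_cons e x.1 h
  source_hd e x h := B.source_hd e x.1 h
  base_tl e x h := B.base_tl e x.1 h
  cons_tl e x h := Prod.ext (B.cons_tl e x.1 h) (sub_add_cancel _ _)
  hd_ne_none x h := B.hd_ne_none x.1 h

theorem snd_foldr_graded (l : List E) (x : X × ℤ) :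
    (l.foldr B.graded.cons x).2 = x.2 + l.length := by
  induction l with
  | nil => simp
  | cons e l ih =>
    change (l.foldr B.graded.cons x).2 + 1 = _
    rw [ih, List.length_cons]
    push_cast
    ring

end BranchingSystem

/-! ### Construction of branching systems with countable fibres -/

section Existence

variable {V : Type u} {E : Type v} {Γ : DirectedGraph V E}

/-- The normalization for one-element types lets an edge that is alone at its source preserve the
`ℕ`-coordinate; exitless cycles then act trivially. -/
theorem exists_equiv_prod_nat (α : Type*) [Finite α] [Nonempty α] :
    ∃ φ : α × ℕ ≃ ℕ, Subsingleton α → ∀ x, φ x = x.2 := by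
  by_cases h : Subsingleton α
  · have := Nonempty.some (nonempty_unique α)
    exact ⟨Equiv.uniqueProd ℕ α, fun _ _ => rfl⟩
  · have : Infinite (α × ℕ) := inferInstance
    obtain ⟨φ⟩ := nonempty_equiv_of_countable (α := α × ℕ) (β := ℕ)
    exact ⟨φ, fun h' => absurd h' h⟩

/-- The fibre `ℕ` over `v` is split into one copy of `ℕ` for each edge from `v` that avoids `H`. If
there is no such edge, all heads are `none`; by saturation this does not happen at a regular `v ∉
H`. -/
theorem exists_local_branching (hΓ : Γ.RowFinite) {H : Set V} (hs : Γ.Saturated H) (v : V) :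
    ∃ (hd : ℕ → Option E) (tl : ℕ → ℕ) (cons : E → ℕ → ℕ),
      (∀ n e, hd n = some e → Γ.s e = v ∧ Γ.r e ∉ H ∧ cons e (tl n) = n) ∧
      (v ∉ H → Γ.IsRegular v → ∀ n, hd n ≠ none) ∧
      ∀ e, Γ.s e = v → Γ.r e ∉ H → ∀ n, hd (cons e n) = some e ∧ tl (cons e n) = n ∧
        ((∀ f, Γ.s f = v → f = e) → cons e n = n) := by
  classical
  have : Finite {e : E // Γ.s e = v ∧ Γ.r e ∉ H} := ((hΓ v).subset fun e he => he.1).to_subtype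
  by_cases hne : Nonempty {e : E // Γ.s e = v ∧ Γ.r e ∉ H}
  · obtain ⟨φ, hφ⟩ := exists_equiv_prod_nat {e : E // Γ.s e = v ∧ Γ.r e ∉ H}
    refine ⟨fun n => some (φ.symm n).1, fun n => (φ.symm n).2,
      fun e n => if he : Γ.s e = v ∧ Γ.r e ∉ H then φ (⟨e, he⟩, n) else n, ?_, ?_, ?_⟩
    · intro n e h
      obtain rfl := Option.some_injective _ h
      refine ⟨(φ.symm n).1.2.1, (φ.symm n).1.2.2, ?_⟩
      refine (dif_pos (φ.symm n).1.2).trans ?_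
      exact φ.apply_symm_apply n
    · exact fun _ _ n => Option.some_ne_none _
    · intro e he hr n
      simp only [dif_pos (And.intro he hr), φ.symm_apply_apply, true_and]
      exact fun h => hφ ⟨fun a b => Subtype.ext ((h a a.2.1).trans (h b b.2.1).symm)⟩ _
  · refine ⟨fun _ => none, id, fun _ => id, by simp, fun hv hreg => ?_, fun e he hr => ?_⟩
    · refine absurd (hs v hreg fun e he => ?_) hv
      by_contra hr
      exact hne ⟨e, he, hr⟩
    · exact absurd ⟨e, he, hr⟩ hne

/-- Every hereditary saturated set of vertices is the set of vertices with empty fibre in some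
branching system. -/
theorem exists_branchingSystem (hΓ : Γ.RowFinite) {H : Set V} (hh : Γ.Hereditary H)
    (hs : Γ.Saturated H) : ∃ B : BranchingSystem Γ ({v // v ∉ H} × ℕ),
      (∀ x, B.base x = x.1) ∧
      ∀ e, (∀ f, Γ.s f = Γ.s e → f = e) → ∀ x, B.base x = Γ.r e → (B.cons e x).2 = x.2 := by
  classical
  choose hd tl cons h₁ h₂ h₃ using exists_local_branching hΓ hs
  have hsrc : ∀ {e}, Γ.r e ∉ H → Γ.s e ∉ H := fun h h' => h (hh _ h')
  have hcons : ∀ {e : E} (he : Γ.r e ∉ H) (x : {v // v ∉ H} × ℕ),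
      (if he : Γ.r e ∉ H then ((⟨Γ.s e, hsrc he⟩, cons (Γ.s e) e x.2) : {v // v ∉ H} × ℕ) else x) =
        (⟨Γ.s e, hsrc he⟩, cons (Γ.s e) e x.2) := fun he x => dif_pos he
  have hbase : ∀ {e : E} {x : {v // v ∉ H} × ℕ}, x.1.1 = Γ.r e → Γ.r e ∉ H :=
    fun {e x} h => h ▸ x.1.2
  have htl : ∀ {e : E} {x : {v // v ∉ H} × ℕ} (h : hd x.1 x.2 = some e),
      ((hd x.1 x.2).elim x fun e =>
        if he : Γ.r e ∉ H then ((⟨Γ.r e, he⟩, tl x.1 x.2) : {v // v ∉ H} × ℕ) else x) =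
      (⟨Γ.r e, (h₁ _ _ _ h).2.1⟩, tl x.1 x.2) := by
    intro e x h
    rw [h]
    exact dif_pos _
  -- The fallback value `x` in `tl` and `cons` is harmless: the axioms constrain `tl` only at points
  -- with a head and `cons e` only over `r(e)`, and there `r(e) ∉ H`.
  refine ⟨{ base := fun x => x.1
            hd := fun x => hd x.1 x.2
            tl := fun x => (hd x.1 x.2).elim x fun e =>
              if he : Γ.r e ∉ H then (⟨Γ.r e, he⟩, tl x.1 x.2) else x
            cons := fun e x =>
              if he : Γ.r e ∉ H then (⟨Γ.s e, hsrc he⟩, cons (Γ.s e) e x.2) else x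
            hd_cons := ?_
            tl_cons := ?_
            base_cons := ?_
            source_hd := ?_
            base_tl := ?_
            cons_tl := ?_
            hd_ne_none := ?_ }, fun _ => rfl, ?_⟩
  · intro e x hx
    rw [hcons (hbase hx)]
    exact (h₃ _ e rfl (hbase hx) _).1
  · intro e x hx
    rw [hcons (hbase hx)]
    have := h₃ _ e rfl (hbase hx) x.2
    rw [htl this.1]
    exact Prod.ext (Subtype.ext hx.symm) this.2.1
  · intro e x hx
    rw [hcons (hbase hx)]
  · exact fun e x h => (h₁ _ _ _ h).1
  · intro e x h
    rw [htl h]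
  · intro e x h
    obtain ⟨hse, hr, hc⟩ := h₁ _ _ _ h
    rw [htl h, hcons hr]
    refine Prod.ext (Subtype.ext hse) ?_
    change cons (Γ.s e) e (tl x.1 x.2) = x.2
    rw [hse, hc]
  · exact fun x hx => h₂ _ x.1.2 hx _
  · intro e he x hx
    change Prod.snd (dite _ _ _) = _
    rw [hcons (hbase hx)]
    exact (h₃ _ e rfl (hbase hx) _).2.2 he

theorem exists_branchingSystem_surjective (hΓ : Γ.RowFinite) :
    ∃ B : BranchingSystem Γ ({v // v ∉ (∅ : Set V)} × ℕ),
      (∀ x, B.base x = x.1) ∧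
      ∀ e, (∀ f, Γ.s f = Γ.s e → f = e) → ∀ x, B.base x = Γ.r e → (B.cons e x).2 = x.2 := by
  refine exists_branchingSystem hΓ (fun e he => he) fun x hx h => ?_
  obtain ⟨e, he⟩ := hx.1
  exact h e he

end Existence

/-! ### Necessity: three faithful representations -/

section Necessity

variable {V : Type u} {E : Type v} {Γ : DirectedGraph V E} {S : Type w} [CommSemiring S]

theorem smul_vertex_injective (hΓ : Γ.RowFinite) (v : V) :
    Function.Injective fun c : S => c • vertex S Γ v := by
  classical
  intro c d h
  obtain ⟨B, hB, -⟩ := exists_branchingSystem_surjective hΓ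
  have h' := congrArg (fun a => B.rep S S a (Finsupp.single (⟨v, Set.notMem_empty v⟩, 0) 1)) h
  simp only [map_smul, LinearMap.smul_apply] at h'
  rw [B.rep_vertex, if_pos (hB _), Finsupp.smul_single, Finsupp.smul_single, smul_eq_mul,
    smul_eq_mul, mul_one, mul_one] at h'
  exact Finsupp.single_injective _ h'

/-- For `ρ` not universal, the representation with coefficients in `S/ρ` is faithful by simplicity,
yet cannot separate `a • v` from `b • v` when `ρ a b`. -/
theorem CongruenceSimple.scalars [Nonempty V] (hΓ : Γ.RowFinite)
    (h : CongruenceSimple (LeavittPathAlgebra S Γ)) (ρ : RingCon S) : ρ = ⊥ ∨ ρ = ⊤ := by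
  classical
  obtain ⟨v⟩ := ‹Nonempty V›
  obtain ⟨B, hB, -⟩ := exists_branchingSystem_surjective hΓ
  refine or_iff_not_imp_right.2 fun hρ => ?_
  have : Nontrivial ρ.Quotient := by
    by_contra hnt
    have hsub := not_nontrivial_iff_subsingleton.1 hnt
    exact hρ (eq_top_iff.2 fun {a b} _ => (RingCon.eq ρ).1 (Subsingleton.elim _ _))
  have : Nonempty ({v : V // v ∉ (∅ : Set V)} × ℕ) := ⟨⟨v, Set.notMem_empty v⟩, 0⟩
  have hbot := (h _).resolve_right (B.comap_rep_ne_top S ρ.Quotient)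
  refine eq_bot_iff.2 fun {a b} hab => ?_
  have hker : (⊥ : RingCon _).comap (B.rep S ρ.Quotient) (a • vertex S Γ v)
      (b • vertex S Γ v) := by
    change B.rep S ρ.Quotient _ = B.rep S ρ.Quotient _
    refine Finsupp.lhom_ext fun x t => ?_
    rw [map_smul, map_smul, LinearMap.smul_apply, LinearMap.smul_apply, B.rep_vertex]
    split_ifs
    · rw [Finsupp.smul_single, Finsupp.smul_single]
      obtain ⟨t⟩ := t
      exact congrArg _ ((RingCon.eq ρ).2 (ρ.mul hab (ρ.refl t)))
    · rw [smul_zero, smul_zero]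
  rw [hbot] at hker
  exact smul_vertex_injective hΓ v hker

/-- For `H ≠ V` the branching system outside `H` is nonempty, so its representation is faithful; it
kills every vertex of `H`, although vertices are nonzero. -/
theorem CongruenceSimple.hereditary_saturated [Nontrivial S] (hΓ : Γ.RowFinite)
    (h : CongruenceSimple (LeavittPathAlgebra S Γ)) {H : Set V} (hh : Γ.Hereditary H)
    (hs : Γ.Saturated H) : H = ∅ ∨ H = Set.univ := by
  classical
  refine or_iff_not_imp_right.2 fun hH => ?_
  obtain ⟨w, hw⟩ := (Set.ne_univ_iff_exists_notMem H).1 hH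
  obtain ⟨B, hB, -⟩ := exists_branchingSystem hΓ hh hs
  have : Nonempty ({v // v ∉ H} × ℕ) := ⟨⟨w, hw⟩, 0⟩
  have hbot := (h _).resolve_right (B.comap_rep_ne_top S S)
  refine Set.eq_empty_of_forall_notMem fun v hv => ?_
  have hker : (⊥ : RingCon _).comap (B.rep S S) (vertex S Γ v) 0 := by
    change B.rep S S _ = B.rep S S _
    refine Finsupp.lhom_ext fun x t => ?_
    rw [B.rep_vertex, if_neg (fun h => x.1.2 (by rwa [← hB, h])), map_zero, LinearMap.zero_apply]
  rw [hbot] at hker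
  have h0 : vertex S Γ v = 0 := hker
  exact one_ne_zero (smul_vertex_injective (S := S) hΓ v
    (a₁ := 1) (a₂ := 0) (by simp only [h0, smul_zero]))

theorem CongruenceSimple.exists_isExit [Nontrivial S] (hΓ : Γ.RowFinite)
    (h : CongruenceSimple (LeavittPathAlgebra S Γ)) {p : List E} (hp : Γ.IsCycle p) :
    ∃ f, Γ.IsExit f p := by
  classical
  by_contra! hexit
  have huniq : ∀ e ∈ p, ∀ f, Γ.s f = Γ.s e → f = e := by
    intro e he f hf
    by_contra hne
    exact hexit f ⟨e, he, hf, hne⟩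
  obtain ⟨B, hB, hcons⟩ := exists_branchingSystem_surjective hΓ
  have hpath := hp.isPath
  set v := Γ.s (p.head hp.ne_nil)
  let x₀ : {v // v ∉ (∅ : Set V)} × ℕ := (⟨v, Set.notMem_empty v⟩, 0)
  have : Nonempty ({v // v ∉ (∅ : Set V)} × ℕ) := ⟨x₀⟩
  have hbot := (h _).resolve_right (B.comap_rep_ne_top S S)
  have hsnd : ∀ (l : List E) (y : V) (x : {v // v ∉ (∅ : Set V)} × ℕ), (∀ e ∈ l, e ∈ p) →
      Γ.IsPath l y (B.base x) → (l.foldr B.cons x).2 = x.2 := by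
    intro l
    induction l with
    | nil => exact fun _ _ _ _ => rfl
    | cons e l ih =>
      intro y x hl hlx
      rw [List.foldr_cons, hcons e (huniq e (hl e List.mem_cons_self)) _
        (B.base_foldr hlx.2 rfl)]
      exact ih _ x (fun f hf => hl f (List.mem_cons_of_mem _ hf)) hlx.2
  have hker : (⊥ : RingCon _).comap (B.rep S S) (path S Γ p v) (vertex S Γ v) := by
    change B.rep S S _ = B.rep S S _
    refine Finsupp.lhom_ext fun x t => ?_
    by_cases hx : B.base x = v
    -- The base returns to `v` because `p` is closed, and the `ℕ`-coordinate is preserved because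
    -- each edge of `p` is the only one at its source.
    · have hfix : p.foldr B.cons x = x := by
        refine Prod.ext (Subtype.ext ?_) (hsnd p v x (fun _ h => h) (hx ▸ hpath))
        rw [← hB, ← hB, B.base_foldr hpath hx, hx]
      rw [B.rep_path S S hpath hx, B.rep_vertex, if_pos hx, hfix]
    · rw [← path_mul_vertex, map_mul, Module.End.mul_apply, B.rep_vertex, if_neg hx, map_zero]
  rw [hbot] at hker
  have heq : path S Γ p v = vertex S Γ v := hker
  -- Faithfulness has forced `p = v` in the algebra. In the graded system `p` raises the degree by
  -- its length and `v` does not, so `p` would be empty.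
  have h₁ := B.graded.rep_path S S hpath (x := (x₀, 0)) (hB x₀) 1
  have h₂ := B.graded.rep_vertex S S v (x₀, 0) 1
  rw [if_pos (show B.graded.base (x₀, 0) = v from hB x₀), ← heq, h₁] at h₂
  have h₃ := congrArg Prod.snd (Finsupp.single_left_injective one_ne_zero h₂)
  rw [B.snd_foldr_graded, zero_add] at h₃
  exact hp.ne_nil (List.length_eq_zero_iff.1 (Int.natCast_eq_zero.1 h₃))

end Necessity

/-! ### Congruence-simple commutative semirings -/

section Scalars

variable {S : Type*} [CommSemiring S]

theorem mul_left_injective_of_simple (h : ∀ ρ : RingCon S, ρ = ⊥ ∨ ρ = ⊤) {a : S} (ha : a ≠ 0)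
    {x y : S} (hxy : a * x = a * y) : x = y := by
  let ρ : RingCon S :=
    { r := fun x y => a * x = a * y
      iseqv := ⟨fun _ => rfl, Eq.symm, Eq.trans⟩
      add' := fun h₁ h₂ => by rw [mul_add, mul_add, h₁, h₂]
      mul' := fun {w x y z} h₁ h₂ => by
        rw [← mul_assoc, h₁, mul_assoc, mul_left_comm, h₂, mul_left_comm] }
  rcases h ρ with h | h
  · have : ρ x y := hxy
    rwa [h] at this
  · have : ρ 1 0 := h ▸ trivial
    exact absurd (show a * 1 = a * 0 from this) (by rwa [mul_one, mul_zero])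

/-- Equality up to adding multiples of `a` is a congruence that identifies `a` with 0, hence is
universal and identifies 1 with 0. -/
theorem exists_one_add_mul_eq_mul (h : ∀ ρ : RingCon S, ρ = ⊥ ∨ ρ = ⊤) {a : S} (ha : a ≠ 0) :
    ∃ x y, 1 + a * x = a * y := by
  let ρ : RingCon S :=
    { r := fun x y => ∃ i j, x + a * i = y + a * j
      iseqv := ⟨fun _ => ⟨0, 0, rfl⟩, fun ⟨i, j, h⟩ => ⟨j, i, h.symm⟩,
        fun {x y z} ⟨i, j, h₁⟩ ⟨k, l, h₂⟩ => ⟨i + k, j + l, by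
          calc x + a * (i + k) = (x + a * i) + a * k := by ring
            _ = (y + a * k) + a * j := by rw [h₁]; ring
            _ = z + a * (j + l) := by rw [h₂]; ring⟩⟩
      add' := fun {w x y z} ⟨i, j, h₁⟩ ⟨k, l, h₂⟩ => ⟨i + k, j + l, by
        calc w + y + a * (i + k) = (w + a * i) + (y + a * k) := by ring
          _ = x + z + a * (j + l) := by rw [h₁, h₂]; ring⟩
      mul' := fun {w x y z} ⟨i, j, h₁⟩ ⟨k, l, h₂⟩ =>
        ⟨i * y + k * w + a * i * k, j * z + l * x + a * j * l, by
          calc w * y + a * (i * y + k * w + a * i * k) = (w + a * i) * (y + a * k) := by ring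
            _ = x * z + a * (j * z + l * x + a * j * l) := by rw [h₁, h₂]; ring⟩ }
  rcases h ρ with h | h
  · have : ρ a 0 := ⟨0, 1, by rw [mul_zero, mul_one, add_comm]⟩
    rw [h] at this
    exact absurd this ha
  · obtain ⟨x, y, hxy⟩ : ρ 1 0 := h ▸ trivial
    exact ⟨x, y, by rw [hxy, zero_add]⟩

/-- A congruence-simple commutative semiring is a field or the Boolean semifield. -/
theorem field_or_boolean_of_simple [Nontrivial S] (h : ∀ ρ : RingCon S, ρ = ⊥ ∨ ρ = ⊤) :
    (∃ F : Field S, F.toCommSemiring = ‹CommSemiring S›) ∨ Nonempty (S ≃+* BooleanSemifield) := by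
  classical
  have hmul : ∀ a b : S, a * b = 0 → a = 0 ∨ b = 0 := fun a b hab =>
    or_iff_not_imp_left.2 fun ha =>
      mul_left_injective_of_simple h ha (hab.trans (mul_zero a).symm)
  by_cases hz : ∀ a b : S, a + b = 0 → a = 0
  · right
    have hz' : ∀ a b : S, a + b = 0 ↔ a = 0 ∧ b = 0 := fun a b =>
      ⟨fun hab => ⟨hz a b hab, hz b a (by rwa [add_comm])⟩, fun hab => by simp [hab]⟩
    -- Without zero divisors and without nonzero additively invertible elements, the support map is
    -- a homomorphism; its kernel congruence separates 0 and 1, so it is injective.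
    let φ : S →+* BooleanSemifield :=
      { toFun := fun a => if a = 0 then 0 else 1
        map_zero' := if_pos rfl
        map_one' := if_neg one_ne_zero
        map_add' := fun a b => by
          by_cases ha : a = 0 <;> by_cases hb : b = 0 <;> simp [hz', ha, hb, BooleanSemifield.one_add_one]
        map_mul' := fun a b => by
          have : a * b = 0 ↔ a = 0 ∨ b = 0 := ⟨hmul a b, by rintro (rfl | rfl) <;> simp⟩
          by_cases ha : a = 0 <;> by_cases hb : b = 0 <;> simp [ha, hb, this] }
    have hφ1 : φ 1 = 1 := map_one φ
    have hinj : Function.Injective φ := by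
      rcases h ((⊥ : RingCon BooleanSemifield).comap φ) with h | h
      · intro a b hab
        have : (⊥ : RingCon BooleanSemifield).comap φ a b := hab
        rwa [h] at this
      · have : (⊥ : RingCon BooleanSemifield).comap φ 1 0 := h ▸ trivial
        have : φ 1 = φ 0 := this
        rw [map_one, map_zero] at this
        cases this
    refine ⟨RingEquiv.ofBijective φ ⟨hinj, fun b => ?_⟩⟩
    rcases b.eq_zero_or_eq_one with rfl | rfl
    · exact ⟨0, map_zero φ⟩
    · exact ⟨1, hφ1⟩
  · left
    push Not at hz
    obtain ⟨a, b, hab, ha⟩ := hz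
    obtain ⟨x, y, hxy⟩ := exists_one_add_mul_eq_mul h ha
    obtain ⟨n, hn⟩ : ∃ n : S, n + 1 = 0 := by
      -- In ring notation `b = -a` and `1 = a y - a x`, so `-1 = a x + b y`.
      refine ⟨a * x + b * y, ?_⟩
      calc a * x + b * y + 1 = (1 + a * x) + b * y := by ring
        _ = (a + b) * y := by rw [hxy]; ring
        _ = 0 := by rw [hab, zero_mul]
    have hneg : ∀ c : S, n * c + c = 0 := fun c => by
      rw [← add_one_mul, hn, zero_mul]
    have hinv : ∀ c : S, ∃ d, (c ≠ 0 → c * d = 1) ∧ (c = 0 → d = 0) := by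
      intro c
      by_cases hc : c = 0
      · exact ⟨0, fun h => absurd hc h, fun _ => rfl⟩
      · obtain ⟨x, y, hxy⟩ := exists_one_add_mul_eq_mul h hc
        -- Here `n = -1`, so `1 + c x = c y` makes `y - x` the inverse of `c`.
        refine ⟨y + n * x, fun _ => ?_, fun h => absurd h hc⟩
        calc c * (y + n * x) = c * y + n * (c * x) := by ring
          _ = 1 + (n * (c * x) + c * x) := by rw [← hxy]; ring
          _ = 1 := by rw [hneg, add_zero]
    choose inv hinv₁ hinv₂ using hinv
    let : Neg S := ⟨fun c => n * c⟩
    exact ⟨{ ‹CommSemiring S›, ‹Nontrivial S› with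
        neg := fun c => n * c
        zsmul := zsmulRec
        neg_add_cancel := hneg
        inv := inv
        mul_inv_cancel := hinv₁
        inv_zero := hinv₂ 0 rfl
        nnqsmul := _
        nnqsmul_def := fun _ _ => rfl
        qsmul := _
        qsmul_def := fun _ _ => rfl }, rfl⟩

end Scalars

end LeavittPath

theorem theorem4p5 {V : Type*} {E : Type*} {S : Type*} [CommSemiring S] [Nontrivial S]
    [Nonempty V] (Γ : LeavittPath.DirectedGraph V E) (hΓ : Γ.RowFinite) :
    LeavittPath.CongruenceSimple (LeavittPath.LeavittPathAlgebra S Γ) ↔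
      ((∃ F : Field S, F.toCommSemiring = ‹CommSemiring S›) ∨
          Nonempty (S ≃+* LeavittPath.BooleanSemifield)) ∧
        (∀ H : Set V, Γ.Hereditary H → Γ.Saturated H → H = ∅ ∨ H = Set.univ) ∧
        (∀ p : List E, Γ.IsCycle p → ∃ f : E, Γ.IsExit f p) := by
  constructor
  · intro h
    exact ⟨LeavittPath.field_or_boolean_of_simple (h.scalars hΓ),
      fun H => h.hereditary_saturated hΓ, fun p => h.exists_isExit hΓ⟩
  · rintro ⟨hS, hH, hcyc⟩
    exact LeavittPath.congruenceSimple_of_scalars hΓ hH hcyc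
      (LeavittPath.exists_affine_of_field_or_boolean hS)
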